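/- **Conventions.** Let $R$ be a commutative noetherian ring. An $R$-complex is a chain complex of $R$-modules indexed by $\mathbb Z$; it is homologically finite if $\coprod_i H_i(X)$ is finitely generated. Put $\inf X=\inf\{i\mid H_i(X)\ne 0\}$, $\operatorname{Supp}X=\bigcup_i\operatorname{Supp}H_i(X)$ and $$\dim_R X=\sup\{\dim(R/\mathfrak p)-\inf(X_{\mathfrak p})\mid \mathfrak p\in\operatorname{Supp}X\}.$$ A prime $\mathfrak p$ is an anchor prime for $X$ if $\dim_{R_{\mathfrak p}}X_{\mathfrak p}=-\inf X_{\mathfrak p}$. Write $K^R(\mathbf x)$ for the Koszul complex. Let $(R,\mathfrak m)$ be local and $X$ a homologically finite $R$-complex. A (Christensen) system of parameters for $X$ is a sequence $\mathbf x=x_1,\dots,x_d$ in $\mathfrak m$ such that $\mathfrak m$ is an anchor prime for $K^R(\mathbf x)\otimes^{\mathbf L}_R X$ and $d=\dim_R X+\inf X$. A length sequence for $X$ is a sequence $\mathbf x$ in $\mathfrak m$ such that every $H_i(K^R(\mathbf x)\otimes^{\mathbf L}_R X)$ has finite length, and $\operatorname{ldim}_R X=m-\inf X$, where $m$ is the length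 of a shortest length sequence for $X$. A DG $R$-algebra $A$ is a positively graded, graded commutative (with $a^2=0$ for $a$ of odd degree) differential graded $R$-algebra. It is noetherian if the ring $H_0(A)$ is noetherian and each $H_i(A)$ is a finitely generated $H_0(A)$-module. If $(R,\mathfrak m)$ is local, $A$ is local if it is noetherian and $H_0(A)$ is a local ring whose maximal ideal contains $\mathfrak mH_0(A)$. **Proposition.** Let $(A_0,\mathfrak m_0)$ be a commutative noetherian local ring, and let $A$ be a local noetherian, homologically finite DG $A_0$-algebra whose degree-zero component is $A_0$. (a) Let $\mathbf x$ be a sequence in $\mathfrak m_0$ that is a system of parameters for the $A_0$-module $H_0(A)$, either in the classical sense (it consists of $\dim_{A_0}H_0(A)$ elements of $\mathfrak m_0$ and $H_0(A)/(\mathbf x)H_0(A)$ has finite length) or in Christensen's sense for $H_0(A)$ viewed as a complex in degree $0$. Then every $H_i(K^{A_0}(\mathbf x)\otimes^{\mathbf L}_{A_0}A)$ has finite length over $A_0$. In particular, $\dim H_0(A)\ge\operatorname{ldim}_{A_0}A$. (b) Let $\mathbf x$ be a Christensen system of parameters for $A$. Then the ring $H_0(A)/(\mathbf x)H_0(A)$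 is artinian. In particular, $\dim_{A_0}(A)\ge\dim H_0(A)$. -/

import Mathlib

open CategoryTheory

universe u

/-! ### Complexes of modules, indexed homologically by `ℤ` -/

/-- Koszul sign rule for complexes indexed homologically by `ℤ`: on a tensor product,
`∂(x ⊗ y) = ∂x ⊗ y + (-1)^|x| x ⊗ ∂y`. -/
instance tensorSignsDownInt : (ComplexShape.down ℤ).TensorSigns where
  ε' := MonoidHom.mk' (fun i : ℤ => i.negOnePow) (fun a b => Int.negOnePow_add a b)
  rel_add p q r hpq := by
    change q + r + 1 = p + r
    have : q + 1 = p := hpq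
    omega
  add_rel p q r hpq := by
    change r + q + 1 = r + p
    have : q + 1 = p := hpq
    omega
  ε'_succ p q hpq := by
    obtain rfl : q + 1 = p := hpq
    change Int.negOnePow q = - Int.negOnePow (q + 1)
    rw [Int.negOnePow_succ, neg_neg]

/-- An `R`-complex: a chain complex of `R`-modules indexed by `ℤ`. -/
abbrev RComplex (R : Type u) [CommRing R] : Type (u + 1) :=
  ChainComplex (ModuleCat.{u} R) ℤ

namespace RComplex

variable {R : Type u} [CommRing R]

/-- An `R`-module, viewed as a complex concentrated in degree `0`. -/
noncomputable def ofModule (M : Type u) [AddCommGroup M] [Module R M] : RComplex R :=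
  (HomologicalComplex.single (ModuleCat.{u} R) (ComplexShape.down ℤ) 0).obj (ModuleCat.of R M)

/-- `X` is homologically finite: its total homology module is finitely generated. -/
def HomologicallyFinite (X : RComplex R) : Prop :=
  Module.Finite R (DirectSum ℤ fun i => (X.homology i : Type u))

/-- `inf X = inf {i ∈ ℤ | H_i(X) ≠ 0}`, which is `+∞` if `X` is acyclic. -/
noncomputable def inf (X : RComplex R) : EReal :=
  ⨅ (i : ℤ) (_ : Nontrivial (X.homology i)), ((i : ℝ) : EReal)

/-- `Supp X = ⋃ i, Supp H_i(X)`. -/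
def supp (X : RComplex R) : Set (PrimeSpectrum R) :=
  ⋃ i : ℤ, Module.support R (X.homology i)

/-- The localization `X_𝔭`, a complex over `R_𝔭`. -/
noncomputable def localizeAt (X : RComplex R) (p : PrimeSpectrum R) :
    RComplex (Localization p.asIdeal.primeCompl) :=
  ((ModuleCat.localizedModuleFunctor.{u} p.asIdeal.primeCompl).mapHomologicalComplex
    (ComplexShape.down ℤ)).obj X

end RComplex

/-- The inclusion of Krull dimensions, elements of `{-∞} ∪ ℕ ∪ {∞}`, in the extended reals. -/
noncomputable def krullDimToEReal (d : WithBot ℕ∞) : EReal :=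
  WithBot.map (fun e : ℕ∞ => WithTop.map (fun n : ℕ => (n : ℝ)) e) d

namespace RComplex

variable {R : Type u} [CommRing R]

/-- The Krull dimension of a complex,
`dim_R X = sup {dim (R/𝔭) - inf (X_𝔭) | 𝔭 ∈ Supp X}`. -/
noncomputable def dim (X : RComplex R) : EReal :=
  ⨆ p ∈ X.supp, (krullDimToEReal (ringKrullDim (R ⧸ p.asIdeal)) - (X.localizeAt p).inf)

/-- `𝔭` is an anchor prime for `X`: `dim_{R_𝔭} X_𝔭 = -inf X_𝔭`. -/
def IsAnchor (X : RComplex R) (p : PrimeSpectrum R) : Prop :=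
  (X.localizeAt p).dim = -(X.localizeAt p).inf

/-- The Koszul complex `K^R(x₁, …, xₙ) = K^R(x₁) ⊗ ⋯ ⊗ K^R(xₙ)`, where `K^R(x)` is the complex
`0 → R → R → 0` in degrees `1` and `0` given by multiplication by `x`. -/
noncomputable def koszul : List R → RComplex R
  | [] => ofModule R
  | x :: xs =>
      HomologicalComplex.tensorObj
        (HomologicalComplex.double (ModuleCat.ofHom (LinearMap.lsmul R R x))
          (show (ComplexShape.down ℤ).Rel 1 0 from rfl))
        (koszul xs)

/-- `K^R(x) ⊗ᴸ X`. As the Koszul complex is a bounded complex of free modules, it is its own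
resolution, and the derived tensor product is the tensor product of complexes. -/
noncomputable def koszulTensor (x : List R) (X : RComplex R) : RComplex R :=
  HomologicalComplex.tensorObj (koszul x) X

section Local

variable [IsLocalRing R]

/-- Christensen's systems of parameters for a complex `X` over the local ring `(R, 𝔪)`: sequences
`x₁, …, x_d` in `𝔪` such that `𝔪` is an anchor prime for `K^R(x) ⊗ᴸ X` and
`d = dim_R X + inf X`. -/
structure IsSystemOfParameters (X : RComplex R) (x : List R) : Prop where
  mem : ∀ r ∈ x, r ∈ IsLocalRing.maximalIdeal R
  anchor : (koszulTensor x X).IsAnchor (IsLocalRing.closedPoint R)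
  length_eq : (x.length : EReal) = X.dim + X.inf

/-- Length sequences for `X`: sequences `x` in `𝔪` such that each `H_i(K^R(x) ⊗ᴸ X)` has finite
length. -/
structure IsLengthSequence (X : RComplex R) (x : List R) : Prop where
  mem : ∀ r ∈ x, r ∈ IsLocalRing.maximalIdeal R
  finite_length : ∀ i : ℤ, IsFiniteLength R ((koszulTensor x X).homology i)

/-- The length dimension of `X`: `ldim_R X = m - inf X`, with `m` the length of a shortest length
sequence for `X`. -/
noncomputable def ldim (X : RComplex R) : EReal :=
  (⨅ (x : List R) (_ : X.IsLengthSequence x), (x.length : EReal)) - X.inf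

end Local

end RComplex

/-- Systems of parameters, in the classical sense, for a finitely generated module `M` over the
local ring `(R, 𝔪)`: sequences of `dim M` elements of `𝔪` such that `M/(x)M` has finite length. -/
structure IsModuleSystemOfParameters (R : Type u) [CommRing R] [IsLocalRing R]
    (M : Type u) [AddCommGroup M] [Module R M] (x : List R) : Prop where
  mem : ∀ r ∈ x, r ∈ IsLocalRing.maximalIdeal R
  finite_length : IsFiniteLength R (M ⧸ (Ideal.ofList x • ⊤ : Submodule R M))
  length_eq : (x.length : WithBot ℕ∞) = Module.supportDim R M

/-! ### DG algebras -/

/-- A positively graded commutative differential graded `R`-algebra, given by its underlying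
algebra `carrier = ⨁ i ≥ 0, gr i` and its differential. -/
structure DGAlgebra (R : Type u) [CommRing R] where
  carrier : Type u
  [ring : Ring carrier]
  [algebra : Algebra R carrier]
  gr : ℕ → Submodule R carrier
  [graded : GradedAlgebra gr]
  d : carrier →ₗ[R] carrier
  d_mem : ∀ (i : ℕ) (a : carrier), a ∈ gr (i + 1) → d a ∈ gr i
  d_gr_zero : ∀ a ∈ gr 0, d a = 0
  d_d : ∀ a, d (d a) = 0
  mul_comm' : ∀ (i j : ℕ) (a b : carrier), a ∈ gr i → b ∈ gr j → b * a = (-1) ^ (i * j) * (a * b)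
  mul_self_odd : ∀ (i : ℕ) (a : carrier), a ∈ gr i → Odd i → a * a = 0
  leibniz : ∀ (i : ℕ) (a b : carrier), a ∈ gr i → d (a * b) = d a * b + (-1) ^ i * (a * d b)

namespace DGAlgebra

attribute [instance] DGAlgebra.ring DGAlgebra.algebra DGAlgebra.graded

variable {R : Type u} [CommRing R] (A : DGAlgebra R)

/-- The homogeneous part of degree `i ∈ ℤ`; it is zero if `i < 0`. -/
def grInt (i : ℤ) : Submodule R A.carrier :=
  if 0 ≤ i then A.gr i.toNat else ⊥

theorem d_mem_grInt {i j : ℤ} (h : j + 1 = i) (a : A.carrier) (ha : a ∈ A.grInt i) :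
    A.d a ∈ A.grInt j := by
  unfold grInt at *
  by_cases hj : 0 ≤ j
  · have hi : 0 ≤ i := by omega
    rw [if_pos hi] at ha
    rw [if_pos hj]
    have : i.toNat = j.toNat + 1 := by omega
    rw [this] at ha
    exact A.d_mem _ _ ha
  · rw [if_neg hj, Submodule.mem_bot]
    by_cases hi : 0 ≤ i
    · rw [if_pos hi] at ha
      have : i.toNat = 0 := by omega
      rw [this] at ha
      exact A.d_gr_zero _ ha
    · rw [if_neg hi, Submodule.mem_bot] at ha
      rw [ha, map_zero]

/-- The `R`-complex `⋯ → A₂ → A₁ → A₀ → 0` underlying a DG algebra. -/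
def toComplex : RComplex R where
  X i := ModuleCat.of R (A.grInt i)
  d i j :=
    if h : j + 1 = i then ModuleCat.ofHom (A.d.restrict (fun a ha => A.d_mem_grInt h a ha)) else 0
  shape i j h := dif_neg h
  d_comp_d' i j k hij hjk := by
    have hij' : j + 1 = i := hij
    have hjk' : k + 1 = j := hjk
    rw [dif_pos hij', dif_pos hjk']
    ext a
    exact A.d_d a.1

/-- `A₀` is a commutative ring. -/
instance gradeZeroCommRing : CommRing (A.gr 0) :=
  { (inferInstance : Ring (A.gr 0)) with
    mul_comm := fun a b => Subtype.ext (by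
      have h := A.mul_comm' 0 0 b a b.2 a.2
      simpa using h) }

/-- The ideal `im(∂₁)` of `A₀`. -/
def boundaryIdeal : Ideal (A.gr 0) where
  carrier := {a | ∃ b ∈ A.gr 1, A.d b = (a : A.carrier)}
  zero_mem' := ⟨0, Submodule.zero_mem _, by simp⟩
  add_mem' := by
    rintro a a' ⟨b, hb, h⟩ ⟨b', hb', h'⟩
    exact ⟨b + b', Submodule.add_mem _ hb hb', by simp [h, h']⟩
  smul_mem' := by
    rintro c a ⟨b, hb, h⟩
    refine ⟨(c : A.carrier) * b, ?_, ?_⟩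
    · have := SetLike.GradedMul.mul_mem (A := A.gr) c.2 hb
      simpa using this
    · rw [A.leibniz 0 _ _ c.2, A.d_gr_zero _ c.2, h]
      simp

/-- The ring `H₀(A) = A₀ / im(∂₁)`. -/
abbrev H0 : Type u := A.gr 0 ⧸ A.boundaryIdeal

/-- `A` is noetherian: the ring `H₀(A)` is noetherian, and each `H_i(A)` is a finitely generated
`H₀(A)`-module (there are finitely many cycles of degree `i` such that every cycle of degree `i` is
an `A₀`-linear combination of them plus a boundary). -/
def IsNoetherian : Prop :=
  IsNoetherianRing A.H0 ∧
    ∀ i : ℕ, ∃ s : Finset A.carrier, (∀ y ∈ s, y ∈ A.gr i ∧ A.d y = 0) ∧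
      ∀ z ∈ A.gr i, A.d z = 0 → ∃ c : A.carrier → A.gr 0, ∃ b ∈ A.gr (i + 1),
        z = ∑ y ∈ s, (c y : A.carrier) * y + A.d b

/-- `A` is local: it is noetherian, and `H₀(A)` is a local ring whose maximal ideal contains
`𝔪 H₀(A)`, where `𝔪` is the maximal ideal of `R`. -/
def IsLocal [IsLocalRing R] : Prop :=
  A.IsNoetherian ∧ ∃ _ : IsLocalRing A.H0,
    (IsLocalRing.maximalIdeal R).map (algebraMap R A.H0) ≤ IsLocalRing.maximalIdeal A.H0

end DGAlgebra

/-!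
Everything rests on comparing supports of homology modules; a finitely generated module over the
noetherian local ring `(R, 𝔪)` has finite length exactly if its support is contained in `{𝔪}`.

For one element `x`, the complex `K(x) ⊗ Y` is `Y_n ⊕ Y_{n-1}` in degree `n`, with differential
`∂(y, y') = (∂y + xy', -∂y')`. This gives the long exact sequence of the multiplication by `x`
(`RComplex.exists_koszul_exact`). By induction on the length of the sequence `x`, using the
associativity of the tensor product, the homology of `K(x) ⊗ X` is finitely generated if that of `X`
is, it is supported on `Supp X ∩ V(x)` (`RComplex.mem_support_koszulTensor_homology`), and if `X` has
no homology in negative degrees then `H_0(K(x) ⊗ X) = H_0(X) / (x) H_0(X)`.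

For the DG algebra `A`, an element `r = ∂b` of `R` acts on cycles by `rz = ∂(bz)`. Hence
`Supp H_n(A) ⊆ Supp H₀(A)` for all `n`, and `K(x) ⊗ A` has homology of finite length as soon as
`Supp H₀(A) ∩ V(x) ⊆ {𝔪}`. Every kind of system of parameters in the statement has this property.
For the classical ones, this set is the support of `H₀(A) / (x) H₀(A)`. For Christensen's, of either `H₀(A)`
or `A`, let `X` be the complex in question. The complex `K(x) ⊗ X` has infimum `0` by Nakayama's
lemma, so if `𝔪` is an anchor prime for it then `dim (R/𝔭) ≤ 0` for each `𝔭` in the support of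
`H_0(K(x) ⊗ X) = H₀(A) / (x) H₀(A)` (`RComplex.support_homology_zero_of_isAnchor`).

The bound on the length dimension follows from the converse of Krull's height theorem for the local
ring `H₀(A)`. The bound `dim H₀(A) ≤ dim A` does not need systems of parameters: `inf (A_𝔭) ≤ 0` for
each prime `𝔭` in `Supp H₀(A)`, so that `dim (R/𝔭) ≤ dim A`.
-/

section

open MonoidalCategory HomologicalComplex

/-! ### The Koszul complex of one element -/

namespace RComplex

variable {R : Type u} [CommRing R]

/-- The complex `0 → R → R → 0` in degrees `1` and `0` given by multiplication by `x`. -/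
noncomputable abbrev koszulOne (x : R) : RComplex R :=
  HomologicalComplex.double (ModuleCat.ofHom (LinearMap.lsmul R R x))
    (show (ComplexShape.down ℤ).Rel 1 0 from rfl)

variable (x : R) (Y : RComplex R)

/-- The tensor product `K(x) ⊗ Y`. -/
noncomputable abbrev koszulOneTensor : RComplex R :=
  HomologicalComplex.tensorObj (koszulOne x) Y

/-- The inclusion `y ↦ e₀ ⊗ y` of `Y_n` in `(K(x) ⊗ Y)_n`. -/
noncomputable def koszulInl (n : ℤ) : Y.X n ⟶ (koszulOneTensor x Y).X n :=
  (λ_ (Y.X n)).inv ≫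
    ((doubleXIso₁ (ModuleCat.ofHom (LinearMap.lsmul R R x)) rfl one_ne_zero).inv ▷ Y.X n) ≫
    ιTensorObj (koszulOne x) Y 0 n n (zero_add n)

/-- The inclusion `y ↦ e₁ ⊗ y` of `Y_m` in `(K(x) ⊗ Y)_n`, where `n = 1 + m`. -/
noncomputable def koszulInr (n m : ℤ) (h : 1 + m = n) :
    Y.X m ⟶ (koszulOneTensor x Y).X n :=
  (λ_ (Y.X m)).inv ≫
    ((doubleXIso₀ (ModuleCat.ofHom (LinearMap.lsmul R R x)) rfl).inv ▷ Y.X m) ≫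
    ιTensorObj (koszulOne x) Y 1 m n h

/-- The coordinate of `K(x)_i` on `e₀`; it is zero unless `i = 0`. -/
noncomputable def koszulCoord₀ (i : ℤ) : (koszulOne x).X i ⟶ 𝟙_ (ModuleCat.{u} R) :=
  if h : i = 0 then ((koszulOne x).XIsoOfEq h).hom ≫
    (doubleXIso₁ (ModuleCat.ofHom (LinearMap.lsmul R R x)) rfl one_ne_zero).hom else 0

/-- The coordinate of `K(x)_i` on `e₁`; it is zero unless `i = 1`. -/
noncomputable def koszulCoord₁ (i : ℤ) : (koszulOne x).X i ⟶ 𝟙_ (ModuleCat.{u} R) :=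
  if h : i = 1 then ((koszulOne x).XIsoOfEq h).hom ≫
    (doubleXIso₀ (ModuleCat.ofHom (LinearMap.lsmul R R x)) rfl).hom else 0

/-- The identity of `Y_n` if `j = n`, and zero otherwise. -/
noncomputable def degreeCoord (j n : ℤ) : Y.X j ⟶ Y.X n :=
  if h : j = n then (Y.XIsoOfEq h).hom else 0

lemma degreeCoord_self (n : ℤ) : degreeCoord Y n n = 𝟙 _ := by
  simp [degreeCoord]

lemma koszulCoord₀_zero : koszulCoord₀ x 0 =
    (doubleXIso₁ (ModuleCat.ofHom (LinearMap.lsmul R R x)) rfl one_ne_zero).hom := by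
  simp [koszulCoord₀]

lemma koszulCoord₀_one : koszulCoord₀ x 1 = 0 := by
  simp [koszulCoord₀]

lemma koszulCoord₁_one : koszulCoord₁ x 1 =
    (doubleXIso₀ (ModuleCat.ofHom (LinearMap.lsmul R R x)) rfl).hom := by
  simp [koszulCoord₁]

lemma koszulCoord₁_zero : koszulCoord₁ x 0 = 0 := by
  simp [koszulCoord₁]

/-- The coefficient of `e₀` in an element of `(K(x) ⊗ Y)_n`. -/
noncomputable def koszulFst (n : ℤ) : (koszulOneTensor x Y).X n ⟶ Y.X n :=
  mapBifunctorDesc (K₁ := koszulOne x) (K₂ := Y)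
    (F := curriedTensor (ModuleCat.{u} R))
    (fun i j _ => (koszulCoord₀ x i ⊗ₘ degreeCoord Y j n) ≫ (λ_ (Y.X n)).hom)

/-- The coefficient of `e₁` in an element of `(K(x) ⊗ Y)_n`. -/
noncomputable def koszulSnd (n m : ℤ) : (koszulOneTensor x Y).X n ⟶ Y.X m :=
  mapBifunctorDesc (K₁ := koszulOne x) (K₂ := Y)
    (F := curriedTensor (ModuleCat.{u} R))
    (fun i j _ => (koszulCoord₁ x i ⊗ₘ degreeCoord Y j m) ≫ (λ_ (Y.X m)).hom)

lemma koszulInl_fst (n : ℤ) : koszulInl x Y n ≫ koszulFst x Y n = 𝟙 _ := by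
  simp [koszulInl, koszulFst, koszulCoord₀_zero, degreeCoord_self, ← comp_whiskerRight_assoc]

lemma koszulInl_snd (n m : ℤ) : koszulInl x Y n ≫ koszulSnd x Y n m = 0 := by
  simp [koszulInl, koszulSnd, koszulCoord₁_zero]

lemma koszulInr_fst (n m : ℤ) (h : 1 + m = n) : koszulInr x Y n m h ≫ koszulFst x Y n = 0 := by
  simp [koszulInr, koszulFst, koszulCoord₀_one]

lemma koszulInr_snd (n m : ℤ) (h : 1 + m = n) :
    koszulInr x Y n m h ≫ koszulSnd x Y n m = 𝟙 _ := by
  simp [koszulInr, koszulSnd, koszulCoord₁_one, degreeCoord_self, ← comp_whiskerRight_assoc]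

lemma koszul_decomposition (n m : ℤ) (h : 1 + m = n) :
    koszulFst x Y n ≫ koszulInl x Y n + koszulSnd x Y n m ≫ koszulInr x Y n m h = 𝟙 _ := by
  apply mapBifunctor.hom_ext
  intro i j hij
  by_cases h0 : i = 0
  · subst h0
    obtain rfl : j = n := by change 0 + j = n at hij; omega
    simp [koszulFst, koszulSnd, koszulCoord₀_zero, koszulCoord₁_zero, degreeCoord_self, koszulInl,
      ← comp_whiskerRight_assoc]
  · by_cases h1 : i = 1
    · subst h1
      obtain rfl : j = m := by change 1 + j = n at hij; omega
      simp [koszulFst, koszulSnd, koszulCoord₀_one, koszulCoord₁_one, degreeCoord_self, koszulInr,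
        ← comp_whiskerRight_assoc]
    · have hz : Limits.IsZero ((koszulOne x).X i) := isZero_double_X _ _ i h1 h0
      exact (((tensorRight (Y.X j)).map_isZero hz)).eq_of_src _ _

lemma koszulInl_d (n m : ℤ) (h : 1 + m = n) :
    koszulInl x Y n ≫ (koszulOneTensor x Y).d n m = Y.d n m ≫ koszulInl x Y m := by
  have hnm : (ComplexShape.down ℤ).Rel n m := by change m + 1 = n; omega
  have h01 : (ComplexShape.down ℤ).Rel 0 (-1) := by change (-1 : ℤ) + 1 = 0; omega
  simp only [koszulInl, Category.assoc, mapBifunctor.d_eq, Preadditive.comp_add,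
    mapBifunctor.ι_D₁, mapBifunctor.ι_D₂]
  rw [mapBifunctor.d₁_eq _ _ _ _ h01 _ _ (by change -1 + n = m; omega),
    mapBifunctor.d₂_eq _ _ _ _ _ hnm _ (by change 0 + m = m; omega),
    double_d_eq_zero₀ _ _ _ _ (by norm_num)]
  have e2 : ComplexShape.ε₂ (ComplexShape.down ℤ) (ComplexShape.down ℤ) (ComplexShape.down ℤ)
      (0, n) = 1 := Int.negOnePow_zero
  rw [e2]
  simp only [Functor.map_zero, NatTrans.app_zero, Limits.zero_comp, smul_zero, Limits.comp_zero,
    zero_add, one_smul, curriedTensor_obj_map, ← whisker_exchange_assoc]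
  exact (leftUnitor_inv_naturality_assoc (Y.d n m) _).symm

lemma koszulInr_d (n m k : ℤ) (h : 1 + m = n) (hk : 1 + k = m) :
    koszulInr x Y n m h ≫ (koszulOneTensor x Y).d n m =
      x • koszulInl x Y m - Y.d m k ≫ koszulInr x Y m k hk := by
  have hmk : (ComplexShape.down ℤ).Rel m k := by change k + 1 = m; omega
  have h01 : (ComplexShape.down ℤ).Rel 1 0 := rfl
  simp only [koszulInr, koszulInl, Category.assoc, mapBifunctor.d_eq, Preadditive.comp_add,
    mapBifunctor.ι_D₁, mapBifunctor.ι_D₂]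
  rw [mapBifunctor.d₁_eq _ _ _ _ h01 _ _ (by change 0 + m = m; omega),
    mapBifunctor.d₂_eq _ _ _ _ _ hmk _ (by change 1 + k = m; omega),
    double_d _ _ one_ne_zero]
  have e1 : ComplexShape.ε₁ (ComplexShape.down ℤ) (ComplexShape.down ℤ) (ComplexShape.down ℤ)
      (1, m) = 1 := rfl
  have e2 : ComplexShape.ε₂ (ComplexShape.down ℤ) (ComplexShape.down ℤ) (ComplexShape.down ℤ)
      (1, m) = -1 := by
    change Int.negOnePow 1 = -1
    simp
  have e3 : (ModuleCat.ofHom (LinearMap.lsmul R R x) : ModuleCat.of R R ⟶ ModuleCat.of R R) ▷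
      Y.X m = x • 𝟙 (ModuleCat.of R R ⊗ Y.X m) := by
    have : (ModuleCat.ofHom (LinearMap.lsmul R R x) : ModuleCat.of R R ⟶ ModuleCat.of R R) =
      x • 𝟙 (ModuleCat.of R R) := rfl
    rw [this, MonoidalLinear.smul_whiskerRight, id_whiskerRight]
  rw [e1, e2]
  simp only [one_smul, curriedTensor_map_app, curriedTensor_obj_map, comp_whiskerRight, e3,
    Category.assoc, Linear.smul_comp, Linear.comp_smul, Category.id_comp, Units.neg_smul,
    Preadditive.comp_neg, ← whisker_exchange_assoc, inv_hom_whiskerRight_assoc, sub_eq_add_neg]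
  congr 2

end RComplex

/-! ### Homology classes and the long exact sequence -/

namespace RComplex

variable {R : Type u} [CommRing R]

/-- The map sending a cycle of degree `j` to its homology class. The neighbouring degrees are
variables `i` and `k`, so that no index has to be rewritten. -/
noncomputable def homologyClass (X : RComplex R) (i j k : ℤ) (hi : 1 + j = i) (hk : 1 + k = j) :
    LinearMap.ker (X.d j k).hom →ₗ[R] X.homology j :=
  ((X.sc' i j k).moduleCatLeftHomologyData.π ≫ (X.sc' i j k).moduleCatHomologyIso.inv ≫
    (X.homologyIsoSc' i j k ((ComplexShape.down ℤ).prev_eq' (show j + 1 = i by omega))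
      ((ComplexShape.down ℤ).next_eq' (show k + 1 = j by omega))).inv).hom

lemma homologyClass_surjective (X : RComplex R) (i j k : ℤ) (hi : 1 + j = i) (hk : 1 + k = j) :
    Function.Surjective (X.homologyClass i j k hi hk) :=
  (ModuleCat.epi_iff_surjective ((X.sc' i j k).moduleCatLeftHomologyData.π ≫
    (X.sc' i j k).moduleCatHomologyIso.inv ≫ (X.homologyIsoSc' i j k _ _).inv)).1 inferInstance

lemma homologyClass_eq_zero_iff (X : RComplex R) (i j k : ℤ) (hi : 1 + j = i) (hk : 1 + k = j)
    (z : LinearMap.ker (X.d j k).hom) :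
    X.homologyClass i j k hi hk z = 0 ↔ ∃ w : X.X i, (X.d i j).hom w = z.1 := by
  have inj : Function.Injective ((X.sc' i j k).moduleCatHomologyIso.inv ≫
      (X.homologyIsoSc' i j k ((ComplexShape.down ℤ).prev_eq' (show j + 1 = i by omega))
        ((ComplexShape.down ℤ).next_eq' (show k + 1 = j by omega))).inv).hom :=
    (ConcreteCategory.bijective_of_isIso _).1
  refine (map_eq_zero_iff _ inj (x := (X.sc' i j k).moduleCatLeftHomologyData.π.hom z)).trans ?_
  refine (Submodule.Quotient.mk_eq_zero (LinearMap.range (X.sc' i j k).moduleCatToCycles)).trans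
    ⟨?_, ?_⟩
  · rintro ⟨w, hw⟩
    exact ⟨w, congrArg Subtype.val hw⟩
  · rintro ⟨w, hw⟩
    exact ⟨w, Subtype.ext hw⟩

/-- A linear map out of the cycles that kills all boundaries factors through the homology. -/
lemma exists_homology_desc (X : RComplex R) (i j k : ℤ) (hi : 1 + j = i) (hk : 1 + k = j)
    {N : Type*} [AddCommGroup N] [Module R N] (φ : LinearMap.ker (X.d j k).hom →ₗ[R] N)
    (hφ : ∀ z w, (X.d i j).hom w = z.1 → φ z = 0) :
    ∃ ψ : X.homology j →ₗ[R] N, ∀ z, ψ (X.homologyClass i j k hi hk z) = φ z := by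
  have hs := X.homologyClass_surjective i j k hi hk
  have hle : LinearMap.ker (X.homologyClass i j k hi hk) ≤ LinearMap.ker φ := fun z hz => by
    obtain ⟨w, hw⟩ := (X.homologyClass_eq_zero_iff i j k hi hk z).1 hz
    exact hφ z w hw
  refine ⟨(Submodule.liftQ _ φ hle).comp
    (LinearMap.quotKerEquivOfSurjective _ hs).symm.toLinearMap, fun z => ?_⟩
  have : (LinearMap.quotKerEquivOfSurjective _ hs).symm (X.homologyClass i j k hi hk z) =
      Submodule.Quotient.mk z := by
    rw [LinearEquiv.symm_apply_eq]
    rfl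
  simp [this]

section Koszul

variable (x : R) (Y : RComplex R)

lemma d_koszulInl_apply (n m : ℤ) (h : 1 + m = n) (y : Y.X n) :
    ((koszulOneTensor x Y).d n m).hom ((koszulInl x Y n).hom y) =
      (koszulInl x Y m).hom ((Y.d n m).hom y) :=
  congr(($(koszulInl_d x Y n m h)).hom y)

lemma d_koszulInr_apply (n m k : ℤ) (h : 1 + m = n) (hk : 1 + k = m) (y : Y.X m) :
    ((koszulOneTensor x Y).d n m).hom ((koszulInr x Y n m h).hom y) =
      (koszulInl x Y m).hom (x • y) - (koszulInr x Y m k hk).hom ((Y.d m k).hom y) := by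
  rw [map_smul]
  exact congr(($(koszulInr_d x Y n m k h hk)).hom y)

lemma koszulFst_koszulInl_apply (n : ℤ) (y : Y.X n) :
    (koszulFst x Y n).hom ((koszulInl x Y n).hom y) = y :=
  congr(($(koszulInl_fst x Y n)).hom y)

lemma koszulSnd_koszulInl_apply (n m : ℤ) (y : Y.X n) :
    (koszulSnd x Y n m).hom ((koszulInl x Y n).hom y) = 0 :=
  congr(($(koszulInl_snd x Y n m)).hom y)

lemma koszulFst_koszulInr_apply (n m : ℤ) (h : 1 + m = n) (y : Y.X m) :
    (koszulFst x Y n).hom ((koszulInr x Y n m h).hom y) = 0 :=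
  congr(($(koszulInr_fst x Y n m h)).hom y)

lemma koszulSnd_koszulInr_apply (n m : ℤ) (h : 1 + m = n) (y : Y.X m) :
    (koszulSnd x Y n m).hom ((koszulInr x Y n m h).hom y) = y :=
  congr(($(koszulInr_snd x Y n m h)).hom y)

lemma koszul_decomposition_apply (n m : ℤ) (h : 1 + m = n) (t : (koszulOneTensor x Y).X n) :
    (koszulInl x Y n).hom ((koszulFst x Y n).hom t) +
      (koszulInr x Y n m h).hom ((koszulSnd x Y n m).hom t) = t :=
  congr(($(koszul_decomposition x Y n m h)).hom t)

lemma koszulFst_d_apply (n m k : ℤ) (h : 1 + m = n) (hk : 1 + k = m)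
    (t : (koszulOneTensor x Y).X n) :
    (koszulFst x Y m).hom (((koszulOneTensor x Y).d n m).hom t) =
      (Y.d n m).hom ((koszulFst x Y n).hom t) + x • (koszulSnd x Y n m).hom t := by
  conv_lhs => rw [← koszul_decomposition_apply x Y n m h t]
  rw [map_add, d_koszulInl_apply x Y n m h, d_koszulInr_apply x Y n m k h hk, map_add, map_sub,
    koszulFst_koszulInl_apply, koszulFst_koszulInl_apply, koszulFst_koszulInr_apply, sub_zero]

lemma koszulSnd_d_apply (n m k : ℤ) (h : 1 + m = n) (hk : 1 + k = m)
    (t : (koszulOneTensor x Y).X n) :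
    (koszulSnd x Y m k).hom (((koszulOneTensor x Y).d n m).hom t) =
      -(Y.d m k).hom ((koszulSnd x Y n m).hom t) := by
  conv_lhs => rw [← koszul_decomposition_apply x Y n m h t]
  rw [map_add, d_koszulInl_apply x Y n m h, d_koszulInr_apply x Y n m k h hk, map_add, map_sub,
    koszulSnd_koszulInl_apply, koszulSnd_koszulInl_apply, koszulSnd_koszulInr_apply, zero_add,
    zero_sub]

/-- The part
`H_n(Y) --x--> H_n(Y) --f--> H_n(K(x) ⊗ Y) --g--> H_{n-1}(Y) --x--> H_{n-1}(Y)`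
of the long exact homology sequence of the multiplication by `x`. -/
lemma exists_koszul_exact (n m : ℤ) (h : 1 + m = n) :
    ∃ (f : Y.homology n →ₗ[R] (koszulOneTensor x Y).homology n)
      (g : (koszulOneTensor x Y).homology n →ₗ[R] Y.homology m),
      Function.Exact f g ∧ (∀ y, f y = 0 ↔ ∃ y', x • y' = y) ∧ ∀ t, x • g t = 0 := by
  obtain ⟨l, hl⟩ : ∃ l, 1 + n = l := ⟨_, rfl⟩
  obtain ⟨k, hk⟩ : ∃ k, 1 + k = m := ⟨m - 1, by omega⟩
  have hT : ∀ t : LinearMap.ker ((koszulOneTensor x Y).d n m).hom,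
      (Y.d n m).hom ((koszulFst x Y n).hom t.1) + x • (koszulSnd x Y n m).hom t.1 = 0 ∧
      (Y.d m k).hom ((koszulSnd x Y n m).hom t.1) = 0 := fun t => by
    have ht := LinearMap.mem_ker.1 t.2
    refine ⟨?_, ?_⟩
    · rw [← koszulFst_d_apply x Y n m k h hk, ht, map_zero]
    · rw [← neg_eq_zero, ← koszulSnd_d_apply x Y n m k h hk, ht, map_zero]
  let inl : LinearMap.ker (Y.d n m).hom →ₗ[R] LinearMap.ker ((koszulOneTensor x Y).d n m).hom :=
    (koszulInl x Y n).hom.restrict (fun y hy => by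
      rw [LinearMap.mem_ker] at hy ⊢
      rw [d_koszulInl_apply x Y n m h, hy, map_zero])
  let snd : LinearMap.ker ((koszulOneTensor x Y).d n m).hom →ₗ[R] LinearMap.ker (Y.d m k).hom :=
    (koszulSnd x Y n m).hom.restrict (fun t ht => (hT ⟨t, ht⟩).2)
  obtain ⟨f, hf⟩ := Y.exists_homology_desc l n m hl h
    ((homologyClass _ l n m hl h).comp inl) (fun z w hw => by
      refine (homologyClass_eq_zero_iff _ l n m hl h _).2 ⟨(koszulInl x Y l).hom w, ?_⟩
      rw [d_koszulInl_apply x Y l n hl, hw]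
      rfl)
  obtain ⟨g, hg⟩ := (koszulOneTensor x Y).exists_homology_desc l n m hl h
    ((homologyClass Y n m k h hk).comp snd) (fun z w hw => by
      refine (homologyClass_eq_zero_iff _ n m k h hk _).2 ⟨-(koszulSnd x Y l n).hom w, ?_⟩
      rw [map_neg, ← koszulSnd_d_apply x Y l n m hl h, hw]
      rfl)
  refine ⟨f, g, fun t => ⟨fun ht => ?_, ?_⟩, fun y => ⟨fun hy => ?_, ?_⟩, fun t => ?_⟩
  · obtain ⟨t, rfl⟩ := homologyClass_surjective _ l n m hl h t
    rw [hg] at ht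
    -- If the `e₁`-coefficient of `t` is `∂w`, then `t + ∂(e₁ ⊗ w)` has no `e₁`-coefficient.
    obtain ⟨w, hw⟩ := (homologyClass_eq_zero_iff _ n m k h hk _).1 ht
    replace hw : (Y.d n m).hom w = (koszulSnd x Y n m).hom t.1 := hw
    refine ⟨homologyClass Y l n m hl h ⟨(koszulFst x Y n).hom t.1 + x • w, ?_⟩, ?_⟩
    · rw [LinearMap.mem_ker, map_add, map_smul, hw]
      exact (hT t).1
    · rw [hf, ← sub_eq_zero, LinearMap.comp_apply, ← map_sub, homologyClass_eq_zero_iff]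
      refine ⟨(koszulInr x Y l n hl).hom w, ?_⟩
      rw [d_koszulInr_apply x Y l n m hl h]
      change _ = (koszulInl x Y n).hom ((koszulFst x Y n).hom t.1 + x • w) - t.1
      rw [hw]
      linear_combination (norm := (rw [map_add]; module))
        -koszul_decomposition_apply x Y n m h t.1
  · rintro ⟨y, rfl⟩
    obtain ⟨y, rfl⟩ := homologyClass_surjective _ l n m hl h y
    rw [hf, LinearMap.comp_apply, hg, LinearMap.comp_apply, homologyClass_eq_zero_iff]
    refine ⟨0, ?_⟩
    rw [map_zero]
    exact (koszulSnd_koszulInl_apply x Y n m y.1).symm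
  · obtain ⟨y, rfl⟩ := homologyClass_surjective _ l n m hl h y
    rw [hf, LinearMap.comp_apply, homologyClass_eq_zero_iff] at hy
    obtain ⟨w, hw⟩ := hy
    replace hw : _ = (koszulInl x Y n).hom y.1 := hw
    have h1 := koszulFst_d_apply x Y l n m hl h w
    have h2 := koszulSnd_d_apply x Y l n m hl h w
    rw [hw, koszulFst_koszulInl_apply] at h1
    rw [hw, koszulSnd_koszulInl_apply, eq_comm, neg_eq_zero] at h2
    refine ⟨homologyClass Y l n m hl h ⟨_, h2⟩, ?_⟩
    rw [← map_smul, ← sub_eq_zero, ← map_sub, homologyClass_eq_zero_iff]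
    refine ⟨-(koszulFst x Y l).hom w, ?_⟩
    change _ = x • (koszulSnd x Y l n).hom w - y.1
    rw [h1, map_neg]
    abel
  · rintro ⟨y, rfl⟩
    obtain ⟨y, rfl⟩ := homologyClass_surjective _ l n m hl h y
    rw [← map_smul, hf, LinearMap.comp_apply, homologyClass_eq_zero_iff]
    refine ⟨(koszulInr x Y l n hl).hom y.1, ?_⟩
    rw [d_koszulInr_apply x Y l n m hl h, LinearMap.mem_ker.1 y.2, map_zero, sub_zero]
    rfl
  · obtain ⟨t, rfl⟩ := homologyClass_surjective _ l n m hl h t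
    rw [hg, LinearMap.comp_apply, ← map_smul, homologyClass_eq_zero_iff]
    refine ⟨-(koszulFst x Y n).hom t.1, ?_⟩
    rw [map_neg, neg_eq_iff_add_eq_zero]
    exact (hT t).1

end Koszul

end RComplex

/-! ### Homology of Koszul tensor products and of localizations -/

namespace RComplex

section KoszulTensor

variable {R : Type u} [CommRing R]

/-- An isomorphism of complexes induces linear equivalences in homology. -/
noncomputable def homologyEquiv {X Y : RComplex R} (e : X ≅ Y) (n : ℤ) :
    X.homology n ≃ₗ[R] Y.homology n :=
  ((homologyFunctor (ModuleCat.{u} R) (ComplexShape.down ℤ) n).mapIso e).toLinearEquiv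

/-- The Koszul complex on the empty sequence is the unit of the tensor product. -/
noncomputable def koszulTensorNil (X : RComplex R) : koszulTensor [] X ≅ X :=
  HomologicalComplex.leftUnitor X

/-- `K(x, xs) ⊗ X` is `K(x) ⊗ (K(xs) ⊗ X)`. -/
noncomputable def koszulTensorCons (x : R) (xs : List R) (X : RComplex R) :
    koszulTensor (x :: xs) X ≅ koszulOneTensor x (koszulTensor xs X) :=
  HomologicalComplex.associator (koszulOne x) (koszul xs) X

/-- The long exact homology sequence that relates `K(x, xs) ⊗ X` to `K(xs) ⊗ X`. -/
lemma exists_koszulTensor_exact (x : R) (xs : List R) (X : RComplex R) (n m : ℤ)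
    (h : 1 + m = n) :
    ∃ (f : (koszulTensor xs X).homology n →ₗ[R] (koszulTensor (x :: xs) X).homology n)
      (g : (koszulTensor (x :: xs) X).homology n →ₗ[R] (koszulTensor xs X).homology m),
      Function.Exact f g ∧ (∀ y, f y = 0 ↔ ∃ y', x • y' = y) ∧ ∀ t, x • g t = 0 := by
  obtain ⟨f, g, hfg, hf, hg⟩ := exists_koszul_exact x (koszulTensor xs X) n m h
  let e := homologyEquiv (koszulTensorCons x xs X) n
  refine ⟨e.symm.toLinearMap.comp f, g.comp e.toLinearMap, fun t => ?_, fun y => ?_, fun t => hg _⟩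
  · rw [LinearMap.comp_apply, hfg]
    simp only [Set.mem_range, LinearMap.comp_apply, LinearEquiv.coe_coe,
      LinearEquiv.symm_apply_eq]
  · rw [← hf]
    simp

lemma koszulTensor_homology_finite [IsNoetherianRing R] {X : RComplex R}
    (hX : ∀ n, Module.Finite R (X.homology n)) (x : List R) (n : ℤ) :
    Module.Finite R ((koszulTensor x X).homology n) := by
  induction x generalizing n with
  | nil => exact Module.Finite.equiv (homologyEquiv (koszulTensorNil X) n).symm
  | cons x xs ih =>
    obtain ⟨f, g, hfg, -⟩ := exists_koszulTensor_exact x xs X n (n - 1) (by omega)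
    have := ih n
    have := ih (n - 1)
    have : IsNoetherian R ((koszulTensor (x :: xs) X).homology n) :=
      isNoetherian_of_range_eq_ker f g hfg.linearMap_ker_eq.symm
    infer_instance

lemma koszulTensor_homology_subsingleton {X : RComplex R}
    (hX : ∀ n < 0, Subsingleton (X.homology n)) (x : List R) (n : ℤ) (hn : n < 0) :
    Subsingleton ((koszulTensor x X).homology n) := by
  induction x generalizing n with
  | nil =>
    have := hX n hn
    exact (homologyEquiv (koszulTensorNil X) n).toEquiv.subsingleton
  | cons x xs ih =>
    obtain ⟨f, g, hfg, -⟩ := exists_koszulTensor_exact x xs X n (n - 1) (by omega)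
    have := ih n hn
    have := ih (n - 1) (by omega)
    refine subsingleton_of_forall_eq 0 fun t => ?_
    obtain ⟨y, rfl⟩ := (hfg t).1 (Subsingleton.elim _ _)
    rw [Subsingleton.elim y 0, map_zero]

/-- If `H_n(X) = 0` for `n < 0`, then `H_0(K(x) ⊗ X)` is `H_0(X) / (x) H_0(X)`. -/
lemma exists_koszulTensor_homology_zero {X : RComplex R}
    (hX : ∀ n < 0, Subsingleton (X.homology n)) (x : List R) :
    ∃ π : X.homology 0 →ₗ[R] (koszulTensor x X).homology 0,
      Function.Surjective π ∧ LinearMap.ker π = Ideal.ofList x • ⊤ := by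
  induction x with
  | nil =>
    refine ⟨(homologyEquiv (koszulTensorNil X) 0).symm.toLinearMap, LinearEquiv.surjective _, ?_⟩
    simp
  | cons x xs ih =>
    obtain ⟨π, hπ, hker⟩ := ih
    obtain ⟨f, g, hfg, hf, -⟩ := exists_koszulTensor_exact x xs X 0 (-1) (by omega)
    have := koszulTensor_homology_subsingleton hX xs (-1) (by omega)
    refine ⟨f.comp π, ?_, ?_⟩
    · rw [LinearMap.coe_comp]
      exact Function.Surjective.comp (fun t => (hfg t).1 (Subsingleton.elim _ _)) hπ
    · ext y
      rw [LinearMap.mem_ker, LinearMap.comp_apply, hf, Ideal.ofList_cons, Submodule.sup_smul,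
        Submodule.ideal_span_singleton_smul, ← hker, Submodule.mem_sup]
      constructor
      · rintro ⟨y', hy'⟩
        obtain ⟨z, rfl⟩ := hπ y'
        refine ⟨x • z, Submodule.smul_mem_pointwise_smul _ _ _ trivial, y - x • z, ?_, by abel⟩
        rw [LinearMap.mem_ker, map_sub, map_smul, hy', sub_self]
      · rintro ⟨a, ha, b, hb, rfl⟩
        obtain ⟨a, -, rfl⟩ := ha
        refine ⟨π a, ?_⟩
        rw [map_add, LinearMap.mem_ker.1 hb, add_zero]
        exact (map_smul π x a).symm

/-- The homology of `K(x) ⊗ X` is supported on the part of `Supp X` where `x` vanishes. -/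
lemma mem_support_koszulTensor_homology {X : RComplex R} {x : List R} {n : ℤ}
    {p : PrimeSpectrum R} (hp : p ∈ Module.support R ((koszulTensor x X).homology n)) :
    (∃ j, p ∈ Module.support R (X.homology j)) ∧ ∀ r ∈ x, r ∈ p.asIdeal := by
  induction x generalizing n with
  | nil =>
    refine ⟨⟨n, ?_⟩, by simp⟩
    rwa [← LinearEquiv.support_eq (homologyEquiv (koszulTensorNil X) n)]
  | cons x xs ih =>
    obtain ⟨f, g, hfg, hf, hg⟩ := exists_koszulTensor_exact x xs X n (n - 1) (by omega)
    have hx : x ∈ p.asIdeal := by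
      -- `x` kills the image of `f`, which is the kernel of `g`, and the image of `g`.
      by_contra hx
      refine Module.notMem_support_iff'.2 (fun t => ?_) hp
      refine ⟨x * x, fun h => hx ((p.2.mem_or_mem h).elim id id), ?_⟩
      obtain ⟨y, hy⟩ := (hfg (x • t)).1 (by rw [map_smul, hg])
      rw [mul_smul, ← hy, ← map_smul, hf]
      exact ⟨y, rfl⟩
    have hor : p ∈ Module.support R ((koszulTensor xs X).homology n) ∨
        p ∈ Module.support R ((koszulTensor xs X).homology (n - 1)) := by
      by_contra! hcon
      refine Module.notMem_support_iff'.2 (fun t => ?_) hp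
      obtain ⟨r, hr, hrt⟩ := Module.notMem_support_iff'.1 hcon.2 (g t)
      obtain ⟨y, hy⟩ := (hfg (r • t)).1 (by rw [map_smul, hrt])
      obtain ⟨s, hs, hsy⟩ := Module.notMem_support_iff'.1 hcon.1 y
      refine ⟨s * r, fun h => (p.2.mem_or_mem h).elim hs hr, ?_⟩
      rw [mul_smul, ← hy, ← map_smul, hsy, map_zero]
    obtain ⟨hj, hxs⟩ := hor.elim ih ih
    exact ⟨hj, by simpa using ⟨hx, hxs⟩⟩

end KoszulTensor

section Localization

variable {R : Type u} [CommRing R]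

/-- Localization is exact, so it commutes with homology. -/
noncomputable def localizeAtHomologyEquiv (X : RComplex R) (p : PrimeSpectrum R) (n : ℤ) :
    (X.localizeAt p).homology n ≃ₗ[Localization p.asIdeal.primeCompl]
      (X.homology n).localizedModule p.asIdeal.primeCompl :=
  (ShortComplex.mapHomologyIso (X.sc n)
    (ModuleCat.localizedModuleFunctor.{u} p.asIdeal.primeCompl)).toLinearEquiv

lemma nontrivial_localizeAt_homology_iff (X : RComplex R) (p : PrimeSpectrum R) (n : ℤ) :
    Nontrivial ((X.localizeAt p).homology n) ↔ p ∈ Module.support R (X.homology n) := by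
  rw [Module.mem_support_iff, (X.localizeAtHomologyEquiv p n).toEquiv.nontrivial_congr]
  exact (IsLocalizedModule.iso p.asIdeal.primeCompl
    ((X.homology n).localizedModuleMkLinearMap
      p.asIdeal.primeCompl)).symm.toEquiv.nontrivial_congr

lemma inf_le_of_nontrivial (X : RComplex R) (n : ℤ) (h : Nontrivial (X.homology n)) :
    X.inf ≤ ((n : ℝ) : EReal) :=
  iInf₂_le n h

lemma inf_eq_zero {X : RComplex R} (hX : ∀ n < 0, Subsingleton (X.homology n))
    (h0 : Nontrivial (X.homology 0)) : X.inf = 0 := by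
  refine le_antisymm (by simpa using X.inf_le_of_nontrivial 0 h0) (le_iInf₂ fun n hn => ?_)
  have : 0 ≤ n := by
    by_contra! h
    exact not_subsingleton_iff_nontrivial.2 hn (hX n h)
  exact_mod_cast this

end Localization

end RComplex

end

/-! ### Dimension, length and anchor primes -/

lemma krullDimToEReal_coe (n : ℕ) : krullDimToEReal (n : WithBot ℕ∞) = n := rfl

lemma krullDimToEReal_mono : Monotone krullDimToEReal := by
  refine WithBot.monotone_map_iff.2 (WithTop.monotone_map_iff.2 Nat.mono_cast)

lemma krullDimToEReal_nonpos {d : WithBot ℕ∞} (h : krullDimToEReal d ≤ 0) : d ≤ 0 := by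
  by_contra! hd
  have h1 : (1 : WithBot ℕ∞) ≤ d := by
    induction d with
    | bot => simp at hd
    | coe d => exact_mod_cast Order.one_le_iff_pos.2 (WithBot.coe_pos.1 hd)
  have h2 : krullDimToEReal (1 : WithBot ℕ∞) ≤ 0 := (krullDimToEReal_mono h1).trans h
  have h3 : krullDimToEReal (1 : WithBot ℕ∞) = 1 := by
    simpa using! krullDimToEReal_coe 1
  rw [h3] at h2
  exact absurd h2 (by norm_num)

/-- A prime `𝔭` with `dim (R/𝔭) ≤ 0` is maximal. -/
lemma isMaximal_of_ringKrullDim_quotient_nonpos {R : Type*} [CommRing R] (p : Ideal R) [p.IsPrime]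
    (h : ringKrullDim (R ⧸ p) ≤ 0) : p.IsMaximal := by
  have : Ring.KrullDimLE 0 (R ⧸ p) := by
    rw [Ring.krullDimLE_iff]
    exact_mod_cast h
  have : (⊥ : Ideal (R ⧸ p)).IsMaximal := Ideal.isMaximal_of_isPrime _
  exact Ideal.Quotient.maximal_of_isField p (Ring.isField_iff_maximal_bot.2 this)

/-- A finitely generated module over a noetherian local ring supported at the maximal ideal only
has finite length. -/
lemma isFiniteLength_of_support {R : Type*} [CommRing R] [IsLocalRing R] [IsNoetherianRing R]
    {M : Type*} [AddCommGroup M] [Module R M] [Module.Finite R M]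
    (h : ∀ p ∈ Module.support R M, p = IsLocalRing.closedPoint R) : IsFiniteLength R M := by
  rw [isFiniteLength_iff_isNoetherian_isArtinian]
  refine ⟨inferInstance, ?_⟩
  let I := Module.annihilator R M
  have hdim : Ring.KrullDimLE 0 (R ⧸ I) := by
    rw [Ideal.krullDimLE_zero_quotient_iff_forall_minimalPrimes_isMaximal]
    intro J hJ
    have := hJ.1.1
    have hp := h ⟨J, this⟩ (Module.mem_support_iff_of_finite.2 hJ.1.2)
    have hJm : J = IsLocalRing.maximalIdeal R := congrArg PrimeSpectrum.asIdeal hp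
    rw [hJm]
    infer_instance
  have : IsArtinianRing (R ⧸ I) := isArtinianRing_iff_krullDimLE_zero.2 hdim
  let _ : Module (R ⧸ I) M := Module.quotientAnnihilator
  have : IsScalarTower R (R ⧸ I) M := Module.IsTorsionBySet.isScalarTower _
  have : Module.Finite (R ⧸ I) M := Module.Finite.of_restrictScalars_finite R _ _
  exact isArtinian_of_surjective_algebraMap (R := R ⧸ I) Ideal.Quotient.mk_surjective

lemma eq_closedPoint_of_mem_support_of_isFiniteLength {R : Type*} [CommRing R] [IsLocalRing R]
    {M : Type*} [AddCommGroup M] [Module R M] (h : IsFiniteLength R M) :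
    ∀ p ∈ Module.support R M, p = IsLocalRing.closedPoint R := by
  intro p hp
  induction h with
  | of_subsingleton => exact absurd hp (by simp [Module.support_eq_empty])
  | @of_simple_quotient M _ _ N _ h ih =>
    rw [Module.support_of_exact (LinearMap.exact_subtype_mkQ N) N.injective_subtype
      N.mkQ_surjective] at hp
    refine hp.elim ih fun hp => ?_
    obtain ⟨m, hm, ⟨e⟩⟩ := isSimpleModule_iff_quot_maximal.1 ‹IsSimpleModule R (M ⧸ N)›
    rw [e.support_eq, Module.mem_support_iff_of_finite, Ideal.annihilator_quotient] at hp
    exact PrimeSpectrum.ext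
      ((hm.eq_of_le p.2.ne_top hp).symm.trans (IsLocalRing.eq_maximalIdeal hm))

/-- If `𝔪` is the only prime in `Supp S` that contains `x`, then `S / (x) S` has finite length over
`R`, so it is artinian. -/
lemma isArtinianRing_quotient_map_ofList {R S : Type*} [CommRing R] [IsLocalRing R]
    [IsNoetherianRing R] [CommRing S] [Algebra R S]
    (hsurj : Function.Surjective (algebraMap R S)) {x : List R}
    (h : ∀ p ∈ Module.support R S, (∀ r ∈ x, r ∈ p.asIdeal) → p = IsLocalRing.closedPoint R) :
    IsArtinianRing (S ⧸ (Ideal.ofList x).map (algebraMap R S)) := by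
  have hS : Module.Finite R S := Module.Finite.of_surjective (Algebra.linearMap R S) hsurj
  have hlen : IsFiniteLength R (S ⧸ (Ideal.ofList x).map (algebraMap R S)) := by
    refine isFiniteLength_of_support fun p hp => ?_
    rw [Module.support_of_algebra] at hp
    refine h p ?_ fun r hr => hp (RingHom.mem_ker.2 ?_)
    · rw [Module.support_of_algebra]
      intro r hr
      refine hp (RingHom.mem_ker.2 ?_)
      rw [IsScalarTower.algebraMap_apply R S, RingHom.mem_ker.1 hr, map_zero]
    · exact Ideal.Quotient.eq_zero_iff_mem.2 (Ideal.mem_map_of_mem _ (Ideal.subset_span hr))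
  exact isArtinian_of_tower R (isFiniteLength_iff_isNoetherian_isArtinian.1 hlen).2

/-- The primes `𝔭` of a finite-dimensional ring detect its dimension as a supremum of the
dimensions of the rings `R/𝔭`. -/
lemma krullDimToEReal_ringKrullDim_le {R : Type*} [CommRing R] [FiniteRingKrullDim R] {c : EReal}
    (h : ∀ p : PrimeSpectrum R, krullDimToEReal (ringKrullDim (R ⧸ p.asIdeal)) ≤ c) :
    krullDimToEReal (ringKrullDim R) ≤ c := by
  let l := LTSeries.longestOf (PrimeSpectrum R)
  have hl : ringKrullDim R = l.length := Order.krullDim_eq_length_of_finiteDimensionalOrder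
  refine le_trans (krullDimToEReal_mono ?_) (h l.head)
  rw [hl, ringKrullDim_quotient]
  let l' : LTSeries (PrimeSpectrum.zeroLocus (l.head.asIdeal : Set R)) :=
    LTSeries.mk l.length (fun i => ⟨l i, l.head_le i⟩) (fun i j hij => l.strictMono hij)
  exact Order.LTSeries.length_le_krullDim l'

namespace RComplex

/-- If `H_n(X) = 0` for `n < 0` and `𝔪` is an anchor prime for `X`, then `H_0(X)` is supported at
`𝔪` only: a prime `𝔭` in the support has `dim (R/𝔭) ≤ dim (R/𝔭) - inf (X_𝔭) ≤ 0`. The computation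
takes place over `R_𝔪`, which is identified with `R`. -/
lemma support_homology_zero_of_isAnchor {R : Type u} [CommRing R] [IsLocalRing R] {X : RComplex R}
    (hX : ∀ n < 0, Subsingleton (X.homology n)) (h0 : Nontrivial (X.homology 0))
    (hm : X.IsAnchor (IsLocalRing.closedPoint R)) :
    ∀ p ∈ Module.support R (X.homology 0), p = IsLocalRing.closedPoint R := by
  intro p hp
  set m := IsLocalRing.closedPoint R
  set Y := X.localizeAt m
  have hY0 : Y.inf = 0 := by
    refine inf_eq_zero (fun n hn => ?_) ?_
    · by_contra hcon
      rw [not_subsingleton_iff_nontrivial, nontrivial_localizeAt_homology_iff] at hcon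
      have := hX n hn
      rw [Module.support_eq_empty] at hcon
      exact hcon
    · rw [nontrivial_localizeAt_homology_iff]
      exact IsLocalRing.closedPoint_mem_support R _
  have hdim : Y.dim = 0 := by rw [hm, hY0, neg_zero]
  have hunits : m.asIdeal.primeCompl ≤ IsUnit.submonoid R := fun r hr => by
    by_contra hu
    exact hr hu
  let e := IsLocalization.atUnits R m.asIdeal.primeCompl hunits
    (S := Localization m.asIdeal.primeCompl)
  -- `q` is the prime of `R_𝔪` that corresponds to `p`.
  let q : PrimeSpectrum (Localization m.asIdeal.primeCompl) := p.comap e.symm.toRingHom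
  have hq : q ∈ Module.support _ (Y.homology 0) := by
    rw [LinearEquiv.support_eq (X.localizeAtHomologyEquiv m 0)]
    obtain ⟨y, hy⟩ := Module.mem_support_iff'.1 hp
    refine Module.mem_support_iff'.2 ⟨(X.homology 0).localizedModuleMkLinearMap _ y, ?_⟩
    intro s hs hsy
    obtain ⟨r, rfl⟩ := e.surjective s
    have hr : r ∉ p.asIdeal := fun h => hs (by
      change e.symm (e r) ∈ p.asIdeal
      rwa [e.symm_apply_apply])
    have her : e r = algebraMap R _ r := e.commutes r
    rw [her, algebraMap_smul, ← map_smul,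
      IsLocalizedModule.eq_zero_iff m.asIdeal.primeCompl] at hsy
    obtain ⟨c, hc⟩ := hsy
    exact hy r hr (((hunits c.2).smul_eq_zero).1 hc)
  have hqY : q ∈ Y.supp := Set.mem_iUnion.2 ⟨0, hq⟩
  have hle : krullDimToEReal (ringKrullDim (_ ⧸ q.asIdeal)) - (Y.localizeAt q).inf ≤ 0 := by
    rw [← hdim]
    exact le_iSup₂ (f := fun (q : PrimeSpectrum (Localization m.asIdeal.primeCompl))
      (_ : q ∈ Y.supp) => krullDimToEReal (ringKrullDim (_ ⧸ q.asIdeal)) -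
        (Y.localizeAt q).inf) q hqY
  have hinf : (Y.localizeAt q).inf ≤ 0 := by
    simpa using (Y.localizeAt q).inf_le_of_nontrivial 0
      ((nontrivial_localizeAt_homology_iff Y q 0).2 hq)
  have hmax : q.asIdeal.IsMaximal := by
    apply isMaximal_of_ringKrullDim_quotient_nonpos
    apply krullDimToEReal_nonpos
    refine le_trans ?_ hle
    rw [sub_eq_add_neg]
    exact le_add_of_nonneg_right (by simpa using EReal.neg_le_neg_iff.2 hinf)
  have hpmax : p.asIdeal.IsMaximal := by
    have : p.asIdeal = q.asIdeal.comap e.toRingHom := by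
      ext r
      change r ∈ p.asIdeal ↔ e.symm (e r) ∈ p.asIdeal
      rw [e.symm_apply_apply]
    rw [this]
    exact Ideal.comap_isMaximal_of_surjective _ e.surjective
  exact PrimeSpectrum.ext (IsLocalRing.eq_maximalIdeal hpmax)

end RComplex

/-! ### The complex underlying a DG algebra -/

namespace DGAlgebra

variable {R : Type u} [CommRing R] (A : DGAlgebra R)

lemma toComplex_d_apply {i j : ℤ} (h : 1 + j = i) (a : A.grInt i) :
    (A.toComplex.d i j).hom a =
      (⟨A.d a, A.d_mem_grInt (by omega) a a.2⟩ : A.grInt j) := by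
  have h' : j + 1 = i := by omega
  have : A.toComplex.d i j =
      ModuleCat.ofHom (A.d.restrict (fun a ha => A.d_mem_grInt h' a ha)) := dif_pos h'
  rw [this]
  rfl

lemma grInt_natCast (n : ℕ) : A.grInt n = A.gr n := by
  simp [grInt]

lemma grInt_eq_bot {n : ℤ} (hn : n < 0) : A.grInt n = ⊥ :=
  if_neg (by omega)

lemma toComplex_homology_subsingleton {n : ℤ} (hn : n < 0) :
    Subsingleton (A.toComplex.homology n) := by
  refine subsingleton_of_forall_eq 0 fun t => ?_
  obtain ⟨z, rfl⟩ := A.toComplex.homologyClass_surjective (1 + n) n (n - 1) rfl (by omega) t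
  have hz : z = 0 := by
    apply Subtype.ext
    apply Subtype.ext
    exact (Submodule.mem_bot R).1 ((A.grInt_eq_bot hn).le z.1.2)
  rw [hz, map_zero]

/-- The ring `H₀(A)` is the homology in degree `0` of the underlying complex. -/
lemma nonempty_H0_equiv_homology_zero : Nonempty (A.H0 ≃ₗ[R] A.toComplex.homology 0) := by
  let i₀ : A.gr 0 →ₗ[R] LinearMap.ker (A.toComplex.d 0 (-1)).hom :=
    LinearMap.codRestrict _ (Submodule.inclusion (A.grInt_natCast 0).ge) (fun a => by
      refine (A.toComplex_d_apply rfl _).trans (Subtype.ext ?_)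
      exact A.d_gr_zero _ a.2)
  have hi₀ : Function.Surjective i₀ := fun z =>
    ⟨⟨z.1.1, (A.grInt_natCast 0).le z.1.2⟩, rfl⟩
  let ψ : A.gr 0 →ₗ[R] A.toComplex.homology 0 :=
    (A.toComplex.homologyClass 1 0 (-1) rfl rfl).comp i₀
  have hψ : Function.Surjective ψ :=
    (A.toComplex.homologyClass_surjective 1 0 (-1) rfl rfl).comp hi₀
  let q : A.gr 0 →ₗ[R] A.H0 := (Ideal.Quotient.mkₐ R A.boundaryIdeal).toLinearMap
  have hq : Function.Surjective q := Ideal.Quotient.mk_surjective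
  have hker : LinearMap.ker q = LinearMap.ker ψ := by
    ext a
    rw [LinearMap.mem_ker, LinearMap.mem_ker, LinearMap.comp_apply,
      RComplex.homologyClass_eq_zero_iff]
    refine Ideal.Quotient.eq_zero_iff_mem.trans ⟨?_, ?_⟩
    · rintro ⟨b, hb, hba⟩
      exact ⟨⟨b, (A.grInt_natCast 1).ge hb⟩,
        (A.toComplex_d_apply rfl _).trans (Subtype.ext hba)⟩
    · rintro ⟨w, hw⟩
      exact ⟨w.1, (A.grInt_natCast 1).le w.2, congrArg (Subtype.val (p := (· ∈ A.grInt 0)))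
        ((A.toComplex_d_apply rfl w).symm.trans hw)⟩
  exact ⟨(q.quotKerEquivOfSurjective hq).symm ≪≫ₗ Submodule.quotEquivOfEq _ _ hker ≪≫ₗ
    ψ.quotKerEquivOfSurjective hψ⟩

/-- If `r = ∂b` in `A`, then `rz = ∂(bz)` for each cycle `z`. So `H(A)` is an `H₀(A)`-module. -/
lemma smul_homology_eq_zero {r : R} (hr : algebraMap R A.H0 r = 0) (n : ℤ)
    (t : A.toComplex.homology n) : r • t = 0 := by
  by_cases hn : n < 0
  · have := A.toComplex_homology_subsingleton hn
    exact Subsingleton.elim _ _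
  lift n to ℕ using by omega
  obtain ⟨z, rfl⟩ := A.toComplex.homologyClass_surjective (n + 1 : ℕ) n (n - 1)
    (by push_cast; omega) (by omega) t
  obtain ⟨b, hb, hbr⟩ := Ideal.Quotient.eq_zero_iff_mem.1 hr
  have hdz : A.d (z.1.1) = 0 :=
    congrArg Subtype.val ((A.toComplex_d_apply (j := n - 1) (by omega) z.1).symm.trans z.2)
  rw [← map_smul, RComplex.homologyClass_eq_zero_iff]
  refine ⟨⟨b * z.1.1, ?_⟩, ?_⟩
  · rw [grInt_natCast, add_comm n 1]
    exact SetLike.mul_mem_graded hb ((A.grInt_natCast n).le z.1.2)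
  · refine (A.toComplex_d_apply (by push_cast; omega) _).trans (Subtype.ext ?_)
    change A.d (b * z.1.1) = _
    rw [A.leibniz 1 _ _ hb, hdz, mul_zero, mul_zero, add_zero, hbr]
    exact (Algebra.smul_def r z.1.1).symm

end DGAlgebra

/-! ### Parameters and finite length -/

namespace RComplex

variable {R : Type u} [CommRing R]

lemma HomologicallyFinite.homology_finite {X : RComplex R} (hX : X.HomologicallyFinite) (n : ℤ) :
    Module.Finite R (X.homology n) := by
  have : Module.Finite R (DirectSum ℤ fun i => (X.homology i : Type u)) := hX
  exact Module.Finite.of_surjective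
    (DirectSum.component R ℤ (fun i => (X.homology i : Type u)) n)
    (fun y => ⟨DirectSum.lof R ℤ (fun i => (X.homology i : Type u)) n y,
      DirectSum.component.lof_self R (M := fun i => (X.homology i : Type u)) n y⟩)

/-- If `𝔪` is an anchor prime for `K(x) ⊗ X`, then `H_0(X) / (x) H_0(X)` is supported at `𝔪` only:
by Nakayama's lemma it is nonzero, so it is the lowest homology module of `K(x) ⊗ X`. -/
lemma eq_closedPoint_of_isAnchor_koszulTensor [IsLocalRing R] {X : RComplex R}
    (hX : ∀ n < 0, Subsingleton (X.homology n)) [Nontrivial (X.homology 0)]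
    [Module.Finite R (X.homology 0)] {x : List R} (hx : ∀ r ∈ x, r ∈ IsLocalRing.maximalIdeal R)
    (ha : (koszulTensor x X).IsAnchor (IsLocalRing.closedPoint R)) {p : PrimeSpectrum R}
    (hp : p ∈ Module.support R (X.homology 0)) (hxp : ∀ r ∈ x, r ∈ p.asIdeal) :
    p = IsLocalRing.closedPoint R := by
  obtain ⟨π, hπ, hker⟩ := exists_koszulTensor_homology_zero hX x
  have hnt : Nontrivial ((koszulTensor x X).homology 0) := by
    by_contra hcon
    rw [not_nontrivial_iff_subsingleton] at hcon
    have htop : Ideal.ofList x • (⊤ : Submodule R (X.homology 0)) = ⊤ := by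
      rw [← hker, LinearMap.ker_eq_top]
      exact LinearMap.ext fun _ => Subsingleton.elim _ _
    have hle : Ideal.ofList x ≤ Ideal.jacobson ⊥ := by
      rw [IsLocalRing.jacobson_eq_maximalIdeal ⊥ bot_ne_top]
      exact Ideal.span_le.2 hx
    exact top_ne_bot (Submodule.eq_bot_of_le_smul_of_le_jacobson_bot (Ideal.ofList x) ⊤
      Module.Finite.fg_top htop.ge hle)
  refine support_homology_zero_of_isAnchor (koszulTensor_homology_subsingleton hX x) hnt ha p ?_
  rw [← LinearEquiv.support_eq (π.quotKerEquivOfSurjective hπ), hker, Module.support_quotient]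
  exact ⟨hp, Ideal.span_le.2 hxp⟩

lemma ofModule_homology_subsingleton (M : Type u) [AddCommGroup M] [Module R M] {n : ℤ}
    (hn : n ≠ 0) : Subsingleton ((ofModule (R := R) M).homology n) :=
  ModuleCat.subsingleton_of_isZero
    (HomologicalComplex.isZero_single_obj_homology (ComplexShape.down ℤ) 0 (ModuleCat.of R M) n hn)

/-- The homology in degree `0` of a module viewed as a complex is the module. -/
noncomputable def ofModuleHomologyEquiv (M : Type u) [AddCommGroup M] [Module R M] :
    (ofModule (R := R) M).homology 0 ≃ₗ[R] M :=
  (HomologicalComplex.singleObjHomologySelfIso (ComplexShape.down ℤ) 0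
    (ModuleCat.of R M)).toLinearEquiv

end RComplex

namespace DGAlgebra

variable {R : Type u} [CommRing R] (A : DGAlgebra R)

/-- The homology of `A` is supported on `Supp H₀(A)`, since it is killed by the kernel of
`R → H₀(A)`. -/
lemma mem_support_H0_of_mem_support_homology {n : ℤ} {p : PrimeSpectrum R}
    (hp : p ∈ Module.support R (A.toComplex.homology n)) : p ∈ Module.support R A.H0 := by
  rw [Module.support_of_algebra]
  intro r hr
  by_contra hrp
  exact Module.notMem_support_iff'.2 (fun t => ⟨r, hrp, A.smul_homology_eq_zero hr n t⟩) hp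

lemma toComplex_inf [Nontrivial A.H0] : A.toComplex.inf = 0 := by
  obtain ⟨e⟩ := A.nonempty_H0_equiv_homology_zero
  exact RComplex.inf_eq_zero (fun n hn => A.toComplex_homology_subsingleton hn)
    e.symm.toEquiv.nontrivial

lemma algebraMap_H0_surjective (h : Function.Surjective (algebraMap R (A.gr 0))) :
    Function.Surjective (algebraMap R A.H0) :=
  Ideal.Quotient.mk_surjective.comp h

/-- As `inf (A_𝔭) ≤ 0` for each `𝔭` in `Supp H₀(A)`, the primes over the kernel of `R → H₀(A)`
already give `dim A` at least the dimension of `H₀(A)`. -/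
lemma krullDimToEReal_le_dim [FiniteRingKrullDim A.H0]
    (hsurj : Function.Surjective (algebraMap R A.H0)) :
    krullDimToEReal (ringKrullDim A.H0) ≤ A.toComplex.dim := by
  obtain ⟨e⟩ := A.nonempty_H0_equiv_homology_zero
  refine krullDimToEReal_ringKrullDim_le fun P => ?_
  let p : PrimeSpectrum R := P.comap (algebraMap R A.H0)
  have hp : p ∈ Module.support R (A.toComplex.homology 0) := by
    rw [← e.support_eq, Module.support_of_algebra]
    intro r hr
    change algebraMap R A.H0 r ∈ P.asIdeal
    rw [RingHom.mem_ker.1 hr]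
    exact zero_mem _
  have hinf : (A.toComplex.localizeAt p).inf ≤ 0 := by
    simpa using (A.toComplex.localizeAt p).inf_le_of_nontrivial 0
      ((A.toComplex.nontrivial_localizeAt_homology_iff p 0).2 hp)
  calc krullDimToEReal (ringKrullDim (A.H0 ⧸ P.asIdeal))
      ≤ krullDimToEReal (ringKrullDim (R ⧸ p.asIdeal)) := by
        refine krullDimToEReal_mono (ringKrullDim_le_of_surjective
          (Ideal.quotientMap P.asIdeal (algebraMap R A.H0) le_rfl) ?_)
        exact Ideal.quotientMap_surjective hsurj
    _ ≤ krullDimToEReal (ringKrullDim (R ⧸ p.asIdeal)) - (A.toComplex.localizeAt p).inf := by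
        rw [sub_eq_add_neg]
        exact le_add_of_nonneg_right (by simpa using EReal.neg_le_neg_iff.2 hinf)
    _ ≤ A.toComplex.dim :=
        le_iSup₂ (f := fun (p : PrimeSpectrum R) (_ : p ∈ A.toComplex.supp) =>
          krullDimToEReal (ringKrullDim (R ⧸ p.asIdeal)) - (A.toComplex.localizeAt p).inf)
          p (Set.mem_iUnion.2 ⟨0, hp⟩)

/-- `x` is a length sequence for `A` as soon as `𝔪` is the only prime in `Supp H₀(A)` that
contains `x`. -/
lemma isFiniteLength_koszulTensor_homology [IsLocalRing R] [IsNoetherianRing R]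
    (hfin : A.toComplex.HomologicallyFinite) {x : List R}
    (hx : ∀ p ∈ Module.support R A.H0, (∀ r ∈ x, r ∈ p.asIdeal) → p = IsLocalRing.closedPoint R)
    (n : ℤ) : IsFiniteLength R ((RComplex.koszulTensor x A.toComplex).homology n) := by
  have := RComplex.koszulTensor_homology_finite hfin.homology_finite x n
  refine isFiniteLength_of_support fun p hp => ?_
  obtain ⟨⟨j, hj⟩, hxp⟩ := RComplex.mem_support_koszulTensor_homology hp
  exact hx p (A.mem_support_H0_of_mem_support_homology hj) hxp

/-- By the converse of Krull's height theorem, the maximal ideal of `H₀(A)` is minimal over an ideal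
with `dim H₀(A)` generators. These lift to elements of `R`. -/
lemma exists_parameters [IsLocalRing R] (hlocal : A.IsLocal)
    (hsurj : Function.Surjective (algebraMap R A.H0)) :
    ∃ x : List R, (∀ r ∈ x, r ∈ IsLocalRing.maximalIdeal R) ∧
      (∀ p ∈ Module.support R A.H0, (∀ r ∈ x, r ∈ p.asIdeal) →
        p = IsLocalRing.closedPoint R) ∧
      (x.length : WithBot ℕ∞) = ringKrullDim A.H0 := by
  obtain ⟨⟨hnoeth, -⟩, hloc, hmax⟩ := hlocal
  obtain ⟨s, hs, hcard⟩ := Ideal.exists_finset_card_eq_height_of_isNoetherianRing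
    (IsLocalRing.maximalIdeal A.H0)
  refine ⟨s.toList.map (Function.surjInv hsurj), ?_, ?_, ?_⟩
  · intro r hr
    obtain ⟨y, hy, rfl⟩ := List.mem_map.1 hr
    intro hunit
    have hyn : y ∈ IsLocalRing.maximalIdeal A.H0 :=
      hs.1.2 (Ideal.subset_span (Finset.mem_toList.1 hy))
    refine hyn ?_
    rw [← Function.surjInv_eq hsurj y]
    exact hunit.map (algebraMap R A.H0)
  · intro p hp hxp
    rw [Module.support_of_algebra] at hp
    have hP : (p.asIdeal.map (algebraMap R A.H0)).IsPrime :=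
      Ideal.map_isPrime_of_surjective hsurj hp
    have hsP : Ideal.span (s : Set A.H0) ≤ p.asIdeal.map (algebraMap R A.H0) := by
      refine Ideal.span_le.2 fun y hy => ?_
      rw [← Function.surjInv_eq hsurj y]
      exact Ideal.mem_map_of_mem _ (hxp _ (List.mem_map_of_mem (Finset.mem_toList.2 hy)))
    have hnP := hs.2 ⟨hP, hsP⟩ (IsLocalRing.le_maximalIdeal hP.ne_top)
    -- `p` contains the kernel of `R → H₀(A)`, so it is the preimage of its extension.
    have hmp : IsLocalRing.maximalIdeal R ≤ p.asIdeal := by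
      refine (Ideal.map_le_iff_le_comap.1 (hmax.trans hnP)).trans ?_
      rw [Ideal.comap_map_of_surjective _ hsurj]
      exact sup_le le_rfl hp
    exact PrimeSpectrum.ext
      ((IsLocalRing.maximalIdeal.isMaximal R).eq_of_le p.2.ne_top hmp).symm
  · rw [List.length_map, Finset.length_toList, ← IsLocalRing.maximalIdeal_height_eq_ringKrullDim,
      ← hcard]
    rfl

end DGAlgebra

theorem proposition3p4 {R : Type u} [CommRing R] [IsLocalRing R] [IsNoetherianRing R]
    (A : DGAlgebra R)
    (hA₀ : Function.Bijective (algebraMap R (A.gr 0)))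
    (hlocal : A.IsLocal)
    (hfin : A.toComplex.HomologicallyFinite) :
    ((∀ x : List R,
        (IsModuleSystemOfParameters R A.H0 x ∨
          (RComplex.ofModule (R := R) A.H0).IsSystemOfParameters x) →
        ∀ i : ℤ, IsFiniteLength R ((RComplex.koszulTensor x A.toComplex).homology i)) ∧
      A.toComplex.ldim ≤ krullDimToEReal (ringKrullDim A.H0)) ∧
    ((∀ x : List R, A.toComplex.IsSystemOfParameters x →
        IsArtinianRing (A.H0 ⧸ (Ideal.ofList x).map (algebraMap R A.H0))) ∧
      krullDimToEReal (ringKrullDim A.H0) ≤ A.toComplex.dim) := by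
  have hsurj := A.algebraMap_H0_surjective hA₀.2
  have hH0fin : Module.Finite R A.H0 := Module.Finite.of_surjective (Algebra.linearMap R A.H0) hsurj
  obtain ⟨hnoeth, -⟩ := id hlocal.1
  obtain ⟨hloc, -⟩ := id hlocal.2
  obtain ⟨e⟩ := A.nonempty_H0_equiv_homology_zero
  refine ⟨⟨fun x hx => A.isFiniteLength_koszulTensor_homology hfin fun p hp hxp => ?_, ?_⟩,
    fun x hx => ?_, A.krullDimToEReal_le_dim hsurj⟩
  · obtain hx | hx := hx
    · refine eq_closedPoint_of_mem_support_of_isFiniteLength hx.finite_length p ?_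
      rw [Module.support_quotient]
      exact ⟨hp, Ideal.span_le.2 hxp⟩
    · let e' := RComplex.ofModuleHomologyEquiv (R := R) A.H0
      have := e'.toEquiv.nontrivial
      have := Module.Finite.equiv e'.symm
      refine RComplex.eq_closedPoint_of_isAnchor_koszulTensor
        (fun n hn => RComplex.ofModule_homology_subsingleton _ hn.ne) hx.mem hx.anchor ?_ hxp
      rwa [e'.support_eq]
  · obtain ⟨x, hxm, hx, hlen⟩ := A.exists_parameters hlocal hsurj
    rw [RComplex.ldim, A.toComplex_inf, sub_zero, ← hlen, krullDimToEReal_coe]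
    exact iInf₂_le x ⟨hxm, A.isFiniteLength_koszulTensor_homology hfin hx⟩
  · have := e.symm.toEquiv.nontrivial
    have := Module.Finite.equiv e
    refine isArtinianRing_quotient_map_ofList hsurj fun p hp hxp => ?_
    refine RComplex.eq_closedPoint_of_isAnchor_koszulTensor
      (fun n hn => A.toComplex_homology_subsingleton hn) hx.mem hx.anchor ?_ hxp
    rwa [← e.support_eq]
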